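/- **Theorem 1.** Let $d\ge 1$ be an integer and let $0<p<\bar m\le 1$. Let $a_t^{(i)}$ ($t\ge 0$, $1\le i\le d$) be Bernoulli($p$) random variables and $m_t$ ($t\ge 0$) be Bernoulli($\bar m$) random variables, all mutually independent. A batch of $d$ synchronized queues, run under the optimal policy that serves whenever every queue is nonempty, is the discrete-time Markov chain $(q_t)_{t\ge 0}$ on $\mathbb{N}^d$ ($0\in\mathbb N$) given by $$q_{t+1}=q_t-\mathbf 1\,m_t v_t+a_t,\qquad v_t=\begin{cases}1 & \text{if } q_t^{(i)}\ge 1\text{ for all } i,\\ 0&\text{otherwise,}\end{cases}$$ where $\mathbf 1=(1,\dots,1)$. For $x\in\mathbb N^d$ let $\tau_x=\inf\{t\ge 1: q_t=x\}$ (with $\inf\emptyset=\infty$) for the chain started in $q_0=x$. The state $x$ is *null-recurrent* if $\Pr(\tau_x<\infty)=1$ and $\mathbb E[\tau_x]=\infty$, and *transient* if $\Pr(\tau_x<\infty)<1$. Then: 1. If $d\in\{2,3\}$, the chain is null-recurrent (the batch is quasi-stable): every state that is accessible from the empty state $q=0$ is null-recurrent, and if $\bar m<1$, every state $x\in\mathbb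 N^d$ is null-recurrent. 2. If $d\ge 4$, the chain is transient (the batch is unstable): every state $x\in\mathbb N^d$ is transient. -/

import Mathlib

open MeasureTheory ProbabilityTheory
open scoped ENNReal

namespace SyncQueues

/-- The random input of a batch of `d` synchronized queues: `a t i` tells whether a customer
arrives at queue `i` in slot `t` (Bernoulli with parameter `p`), `m t` tells whether the server is
available in slot `t` (Bernoulli with parameter `mbar`), all of them mutually independent. -/
structure IsBatchInput {d : ℕ} {Ω : Type*} [MeasurableSpace Ω] (μ : Measure Ω) (p mbar : ℝ)
    (a : ℕ → Fin d → Ω → Bool) (m : ℕ → Ω → Bool) : Prop where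
  measurable_arrival : ∀ t i, Measurable (a t i)
  measurable_service : ∀ t, Measurable (m t)
  prob_arrival : ∀ t i, μ {ω | a t i ω = true} = ENNReal.ofReal p
  prob_service : ∀ t, μ {ω | m t ω = true} = ENNReal.ofReal mbar
  indep : iIndepFun (Sum.elim (fun k : ℕ × Fin d => a k.1 k.2) m) μ

/-- The control of the optimal policy: it is activated exactly when every queue is nonempty. -/
def control {d : ℕ} (q : Fin d → ℕ) : ℕ :=
  if ∀ i, 1 ≤ q i then 1 else 0

/-- One time slot, `q ↦ q - 𝟏 * m * v + a`. The control satisfies `v ≤ q i` for every `i`, so that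
the subtraction of natural numbers is never truncated (see `control_le`). -/
def step {d : ℕ} (q : Fin d → ℕ) (arr : Fin d → Bool) (srv : Bool) : Fin d → ℕ :=
  fun i => q i - srv.toNat * control q + (arr i).toNat

theorem control_le {d : ℕ} (q : Fin d → ℕ) (srv : Bool) (i : Fin d) :
    srv.toNat * control q ≤ q i := by
  unfold control
  split_ifs with h
  · have h1 := h i
    cases srv
    · simp
    · simpa using h1
  · simp

/-- The queue state at time `t` when the batch is started in state `x` at time `0`. -/
def queue {d : ℕ} {Ω : Type*} (a : ℕ → Fin d → Ω → Bool) (m : ℕ → Ω → Bool)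
    (x : Fin d → ℕ) : ℕ → Ω → Fin d → ℕ
  | 0, _ => x
  | t + 1, ω => step (queue a m x t ω) (fun i => a t i ω) (m t ω)

/-- The event that the batch started in state `x` returns to `x` at some time `t ≥ 1`. -/
def returnEvent {d : ℕ} {Ω : Type*} (a : ℕ → Fin d → Ω → Bool) (m : ℕ → Ω → Bool)
    (x : Fin d → ℕ) : Set Ω :=
  {ω | ∃ t : ℕ, 1 ≤ t ∧ queue a m x t ω = x}

/-- The first return time `inf {t ≥ 1 | q t = x}` to the starting state `x`
(`∞` if there is no return). -/
noncomputable def returnTime {d : ℕ} {Ω : Type*} (a : ℕ → Fin d → Ω → Bool) (m : ℕ → Ω → Bool)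
    (x : Fin d → ℕ) (ω : Ω) : ℝ≥0∞ :=
  ⨅ (t : ℕ) (_ : 1 ≤ t ∧ queue a m x t ω = x), (t : ℝ≥0∞)

/-- The state `x` is reached from the state `y` with positive probability. -/
def Accessible {d : ℕ} {Ω : Type*} [MeasurableSpace Ω] (μ : Measure Ω)
    (a : ℕ → Fin d → Ω → Bool) (m : ℕ → Ω → Bool) (y x : Fin d → ℕ) : Prop :=
  ∃ t : ℕ, 0 < μ {ω | queue a m y t ω = x}

/-- The state `x` is null-recurrent: the return to `x` is almost certain, but the expected return
time is infinite. -/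
def NullRecurrent {d : ℕ} {Ω : Type*} [MeasurableSpace Ω] (μ : Measure Ω)
    (a : ℕ → Fin d → Ω → Bool) (m : ℕ → Ω → Bool) (x : Fin d → ℕ) : Prop :=
  μ (returnEvent a m x) = 1 ∧ ∫⁻ ω, returnTime a m x ω ∂μ = ⊤

/-- The state `x` is transient: with positive probability there is no return to `x`. -/
def Transient {d : ℕ} {Ω : Type*} [MeasurableSpace Ω] (μ : Measure Ω)
    (a : ℕ → Fin d → Ω → Bool) (m : ℕ → Ω → Bool) (x : Fin d → ℕ) : Prop :=
  μ (returnEvent a m x) < 1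

end SyncQueues

/-! Each service removes one customer from every queue at once, so differences of queue lengths are
driven by the arrivals alone (`queue_add_arrivals_add`). A return to the starting state at time t
therefore forces equal arrival counts in all queues, an event of probability Σ_k b(t,k)^d with b the
binomial weight. This has order t^(-(d-1)/2): from above because every weight is O(t^(-1/2))
(`binomialWeight_le`), from below because O(√t) values of k carry most of the mass
(`le_sum_binomialWeight_pow`).

The identity `last_exit` converts the return probabilities u_t into recurrence properties: if Σ u_t
diverges, return is certain; if it converges, return is not certain; if u_t → 0, the mean return
time is infinite. The upper bound thus gives transience for d ≥ 4 and infinite mean return times for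
d ≥ 2.

Certain return for d ≤ 3 also needs the equalized queues to be short. Start empty, and suppose that
all queues exceed K at time t. Let s be the last time at which some queue i was empty; since then
every available service has been used, so on [s,t) the arrivals at i exceed the services by at least
K. As p < mbar, this is exponentially unlikely in K and t-s. It involves only queue i and the
server, so the other d-1 queues still contribute the factor O(t^(-(d-1)/2)) for equal counts. Summed
over i and s, with K large, such events cost at most half of the lower bound
(`exists_le_measureReal_queue_const`). Hence some diagonal state has visit probabilities with
divergent sum, and communication through the empty state transfers the divergence to every
accessible state. -/

namespace SyncQueues

open Filter Topology Finset

/-! ### Convolutions of sequences -/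

/-- Dominated convergence for series, with `f` as the dominating sequence. Applied to `last_exit`,
whose convolution is constantly 1, it yields contradictions. -/
theorem tendsto_sum_mul_sub_zero {f h : ℕ → ℝ} (hf : Summable f) (hf0 : ∀ n, 0 ≤ f n)
    (hh : Tendsto h atTop (𝓝 0)) (hh1 : ∀ n, |h n| ≤ 1) :
    Tendsto (fun n => ∑ k ∈ range (n + 1), f k * h (n - k)) atTop (𝓝 0) := by
  have key : Tendsto (fun n => ∑' k, if k ∈ range (n + 1) then f k * h (n - k) else 0) atTop
      (𝓝 (∑' _ : ℕ, (0 : ℝ))) := by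
    refine tendsto_tsum_of_dominated_convergence hf ?_ ?_
    · intro k
      have h1 : Tendsto (fun n => f k * h (n - k)) atTop (𝓝 (f k * 0)) :=
        (hh.comp (tendsto_sub_atTop_nat k)).const_mul _
      rw [mul_zero] at h1
      refine h1.congr' ?_
      filter_upwards [eventually_ge_atTop k] with n hn
      rw [if_pos (by simpa using Nat.lt_succ_of_le hn)]
    · refine Eventually.of_forall fun n k => ?_
      split_ifs
      · rw [norm_mul, Real.norm_of_nonneg (hf0 k)]
        exact mul_le_of_le_one_right (hf0 k) (hh1 _)
      · simpa using hf0 k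
  simp only [tsum_zero] at key
  refine key.congr fun n => ?_
  rw [tsum_eq_sum (s := range (n + 1)) (fun k hk => if_neg hk)]
  exact sum_congr rfl fun k hk => if_pos hk

/-! ### Binomial weights -/

/-- The mass of `k` under the binomial distribution with parameters `n` and `p`. -/
noncomputable def binomialWeight (p : ℝ) (n k : ℕ) : ℝ := n.choose k * p ^ k * (1 - p) ^ (n - k)

theorem binomialWeight_nonneg {p : ℝ} (hp0 : 0 ≤ p) (hp1 : p ≤ 1) (n k : ℕ) :
    0 ≤ binomialWeight p n k := by
  have := sub_nonneg.2 hp1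
  unfold binomialWeight
  positivity

theorem binomialWeight_eq_zero_of_lt {p : ℝ} {n k : ℕ} (h : n < k) : binomialWeight p n k = 0 := by
  simp [binomialWeight, Nat.choose_eq_zero_of_lt h]

theorem binomialWeight_succ_zero (p : ℝ) (n : ℕ) :
    binomialWeight p (n + 1) 0 = (1 - p) * binomialWeight p n 0 := by
  simp [binomialWeight, pow_succ']

theorem binomialWeight_succ_succ (p : ℝ) (n k : ℕ) :
    binomialWeight p (n + 1) (k + 1) =
      (1 - p) * binomialWeight p n (k + 1) + p * binomialWeight p n k := by
  unfold binomialWeight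
  rw [Nat.choose_succ_succ, Nat.add_sub_add_right]
  rcases lt_or_ge k n with h | h
  · obtain ⟨j, rfl⟩ := Nat.exists_eq_add_of_lt h
    rw [show k + j + 1 - k = j + 1 by omega, show k + j + 1 - (k + 1) = j by omega]
    push_cast
    ring
  · rw [Nat.choose_eq_zero_of_lt (Nat.lt_succ_of_le h)]
    push_cast
    ring

theorem sum_binomialWeight (p : ℝ) (n : ℕ) : ∑ k ∈ range (n + 1), binomialWeight p n k = 1 := by
  have h := add_pow p (1 - p) n
  rw [add_sub_cancel, one_pow] at h
  rw [h]
  exact sum_congr rfl fun k _ => by unfold binomialWeight; ring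

theorem sum_sq_mul_binomialWeight (p : ℝ) (n : ℕ) :
    ∑ k ∈ range (n + 1), (n * p - k) ^ 2 * binomialWeight p n k = n * p * (1 - p) := by
  have h := congrArg (Polynomial.eval p) (bernsteinPolynomial.variance ℝ n)
  simpa [Polynomial.eval_finsetSum, bernsteinPolynomial, binomialWeight] using h

theorem norm_bernoulli_charFun_le {p θ : ℝ} (hp0 : 0 ≤ p) (hp1 : p ≤ 1) (hθ : |θ| ≤ Real.pi) :
    ‖(p : ℂ) * Complex.exp (θ * Complex.I) + (1 - p : ℝ)‖ ≤
      Real.exp (-(2 * p * (1 - p) / Real.pi ^ 2 * θ ^ 2)) := by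
  refine abs_le_of_sq_le_sq' ?_ (Real.exp_pos _).le |>.2
  have h1 : ‖(p : ℂ) * Complex.exp (θ * Complex.I) + (1 - p : ℝ)‖ ^ 2 =
      1 - 2 * (p * (1 - p)) * (1 - Real.cos θ) := by
    rw [← Complex.normSq_eq_norm_sq, Complex.exp_mul_I, ← Complex.ofReal_cos, ← Complex.ofReal_sin,
      Complex.normSq_apply]
    simp only [Complex.add_re, Complex.add_im, Complex.mul_re, Complex.mul_im, Complex.ofReal_re,
      Complex.ofReal_im, Complex.I_re, Complex.I_im]
    linear_combination p ^ 2 * Real.sin_sq_add_cos_sq θ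
  rw [h1, ← Real.exp_nat_mul]
  refine le_trans ?_ (Real.add_one_le_exp _)
  have h2 := Real.cos_le_one_sub_mul_cos_sq hθ
  have h3 : 0 ≤ p * (1 - p) := mul_nonneg hp0 (sub_nonneg.2 hp1)
  have h4 := mul_le_mul_of_nonneg_left h2 h3
  have h5 : 2 * p * (1 - p) / Real.pi ^ 2 * θ ^ 2 = p * (1 - p) * (2 / Real.pi ^ 2 * θ ^ 2) := by
    ring
  push_cast
  rw [h5]
  linarith

theorem integral_exp_int_mul_I (j : ℤ) (hj : j ≠ 0) :
    ∫ θ in (-Real.pi)..Real.pi, Complex.exp (j * Complex.I * θ) = 0 := by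
  have hc : (j : ℂ) * Complex.I ≠ 0 := mul_ne_zero (by exact_mod_cast hj) Complex.I_ne_zero
  rw [integral_exp_mul_complex hc, div_eq_zero_iff, sub_eq_zero]
  left
  rw [Complex.exp_eq_exp_iff_exists_int]
  exact ⟨j, by push_cast; ring⟩

/-- Fourier inversion: orthogonality of the characters isolates one coefficient of the expanded
power. -/
theorem integral_charFun_pow_mul_exp (p : ℝ) (n k : ℕ) :
    ∫ θ in (-Real.pi)..Real.pi, ((p : ℂ) * Complex.exp (θ * Complex.I) + (1 - p : ℝ)) ^ n *
      Complex.exp (-(k * Complex.I * θ)) = 2 * Real.pi * binomialWeight p n k := by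
  have h1 : ∀ θ : ℝ, ((p : ℂ) * Complex.exp (θ * Complex.I) + (1 - p : ℝ)) ^ n *
      Complex.exp (-(k * Complex.I * θ)) =
      ∑ j ∈ range (n + 1), (binomialWeight p n j : ℂ) *
        Complex.exp (((j : ℤ) - (k : ℤ) : ℤ) * Complex.I * θ) := by
    intro θ
    rw [add_pow, sum_mul]
    refine sum_congr rfl fun j _ => ?_
    rw [mul_pow, ← Complex.exp_nat_mul]
    have : Complex.exp (((j : ℤ) - (k : ℤ) : ℤ) * Complex.I * θ) =
        Complex.exp (j * (θ * Complex.I)) * Complex.exp (-(k * Complex.I * θ)) := by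
      rw [← Complex.exp_add]
      congr 1
      push_cast
      ring
    rw [this]
    unfold binomialWeight
    push_cast
    ring
  simp only [h1]
  rw [intervalIntegral.integral_finsetSum
    (fun j _ => (Continuous.intervalIntegrable (by fun_prop) _ _))]
  simp only [intervalIntegral.integral_const_mul]
  rw [sum_eq_single k]
  · simp
    ring
  · intro j _ hjk
    rw [integral_exp_int_mul_I _ (by omega), mul_zero]
  · intro hk
    rw [binomialWeight_eq_zero_of_lt (by simpa using hk)]
    simp

/-- In the inversion integral the characteristic function is dominated by a Gaussian, whose integral
over the whole line is of order n^(-1/2). -/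
theorem binomialWeight_le {p : ℝ} (hp0 : 0 < p) (hp1 : p < 1) {n : ℕ} (hn : 0 < n) (k : ℕ) :
    binomialWeight p n k ≤ Real.sqrt (Real.pi / (2 * p * (1 - p) / Real.pi ^ 2)) / √n := by
  set c : ℝ := 2 * p * (1 - p) / Real.pi ^ 2 with hc
  have hpi := Real.pi_pos
  have hc0 : 0 < c := by
    have : 0 < 1 - p := sub_pos.2 hp1
    positivity
  have hn' : (0 : ℝ) < n := by exact_mod_cast hn
  have hb := binomialWeight_nonneg hp0.le hp1.le n k
  have hbound : ‖∫ θ in (-Real.pi)..Real.pi, ((p : ℂ) * Complex.exp (θ * Complex.I) +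
      (1 - p : ℝ)) ^ n * Complex.exp (-(k * Complex.I * θ))‖ ≤
      ∫ θ in (-Real.pi)..Real.pi, Real.exp (-(n * c) * θ ^ 2) := by
    refine intervalIntegral.norm_integral_le_of_norm_le (by linarith) ?_
      (Continuous.intervalIntegrable (by fun_prop) _ _)
    refine Eventually.of_forall fun θ hθ => ?_
    have h1 : |θ| ≤ Real.pi := abs_le.2 ⟨hθ.1.le, hθ.2⟩
    have h2 := norm_bernoulli_charFun_le hp0.le hp1.le h1
    have h3 : ‖Complex.exp (-(k * Complex.I * θ))‖ = 1 := by
      rw [show -(k * Complex.I * θ) = ((-(k * θ) : ℝ) : ℂ) * Complex.I by push_cast; ring]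
      exact Complex.norm_exp_ofReal_mul_I _
    rw [norm_mul, h3, mul_one, norm_pow]
    refine (pow_le_pow_left₀ (norm_nonneg _) h2 n).trans (le_of_eq ?_)
    rw [← Real.exp_nat_mul]
    congr 1
    ring
  have hgauss : ∫ θ in (-Real.pi)..Real.pi, Real.exp (-(n * c) * θ ^ 2) ≤
      Real.sqrt (Real.pi / (n * c)) := by
    rw [← integral_gaussian, intervalIntegral.integral_of_le (by linarith)]
    exact setIntegral_le_integral (integrable_exp_neg_mul_sq (by positivity))
      (Eventually.of_forall fun _ => (Real.exp_pos _).le)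
  have h4 := hbound.trans hgauss
  rw [integral_charFun_pow_mul_exp] at h4
  have h5 : ‖(2 * Real.pi * binomialWeight p n k : ℂ)‖ = 2 * Real.pi * binomialWeight p n k := by
    rw [← Complex.ofReal_ofNat, ← Complex.ofReal_mul, ← Complex.ofReal_mul, Complex.norm_real,
      Real.norm_of_nonneg (by positivity)]
  rw [h5] at h4
  have h6 : Real.sqrt (Real.pi / (n * c)) = Real.sqrt (Real.pi / c) / √n := by
    rw [mul_comm, ← div_div, Real.sqrt_div (by positivity)]
  -- The factor 2π in front of the weight is at least 1 and is simply dropped.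
  rw [← h6]
  nlinarith [Real.pi_gt_three]

theorem exists_binomialWeight_le {p : ℝ} (hp0 : 0 < p) (hp1 : p < 1) :
    ∃ C : ℝ, 0 ≤ C ∧ ∀ n : ℕ, 0 < n → ∀ k, binomialWeight p n k ≤ C / √n :=
  ⟨_, Real.sqrt_nonneg _, fun _ hn k => binomialWeight_le hp0 hp1 hn k⟩

/-- By Chebyshev, the window |k - np| < √n has mass at least 3/4, the variance being at most n/4. It
contains at most 2√n + 1 ≤ 3√n integers, and the power mean inequality finishes. -/
theorem le_sum_binomialWeight_pow {p : ℝ} (hp0 : 0 ≤ p) (hp1 : p ≤ 1) {n : ℕ} (hn : 0 < n)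
    (e : ℕ) : (3 / 4 : ℝ) ^ (e + 1) / (3 * √n) ^ e ≤
      ∑ k ∈ range (n + 1), binomialWeight p n k ^ (e + 1) := by
  have hb := binomialWeight_nonneg hp0 hp1 n
  have hn' : (1 : ℝ) ≤ n := by exact_mod_cast hn
  have hs1 : 1 ≤ √(n : ℝ) := Real.one_le_sqrt.2 hn'
  have hss : √(n : ℝ) ^ 2 = n := Real.sq_sqrt (by positivity)
  set I := (range (n + 1)).filter fun k : ℕ => (n * p - k) ^ 2 < (n : ℝ) with hI
  have hmass : (3 / 4 : ℝ) ≤ ∑ k ∈ I, binomialWeight p n k := by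
    have h1 := sum_binomialWeight p n
    rw [← sum_filter_add_sum_filter_not (range (n + 1))
      (fun k : ℕ => (n * p - k) ^ 2 < (n : ℝ))] at h1
    have h2 : n * ∑ k ∈ (range (n + 1)).filter (fun k : ℕ => ¬ (n * p - k) ^ 2 < (n : ℝ)),
        binomialWeight p n k ≤ n * p * (1 - p) := by
      rw [← sum_sq_mul_binomialWeight p n, mul_sum]
      calc _ ≤ ∑ k ∈ (range (n + 1)).filter (fun k : ℕ => ¬ (n * p - k) ^ 2 < (n : ℝ)),
            (n * p - k) ^ 2 * binomialWeight p n k := by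
            refine sum_le_sum fun k hk => ?_
            exact mul_le_mul_of_nonneg_right (not_lt.1 (mem_filter.1 hk).2) (hb k)
        _ ≤ _ := sum_le_sum_of_subset_of_nonneg (filter_subset _ _)
            fun k _ _ => mul_nonneg (sq_nonneg _) (hb k)
    have h3 : n * p * (1 - p) ≤ n * (1 / 4) := by nlinarith [sq_nonneg (p - 1 / 2)]
    have h4 := le_of_mul_le_mul_left (h2.trans h3) (by linarith)
    linarith
  have hcard : (I.card : ℝ) ≤ 3 * √n := by
    have hsub : I ⊆ Icc ⌈n * p - √n⌉₊ ⌊n * p + √n⌋₊ := by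
      intro k hk
      have hk2 : (n * p - k) ^ 2 < √(n : ℝ) ^ 2 := by rw [hss]; exact (mem_filter.1 hk).2
      have hk3 := abs_lt.1 (abs_lt_of_sq_lt_sq hk2 (by positivity))
      rw [mem_Icc]
      exact ⟨Nat.ceil_le.2 (by linarith), Nat.le_floor (by linarith)⟩
    have h1 : I.card ≤ ⌊n * p + √n⌋₊ + 1 - ⌈n * p - √n⌉₊ := by
      simpa using card_le_card hsub
    have h2 : (⌊n * p + √n⌋₊ : ℝ) ≤ n * p + √n := Nat.floor_le (by positivity)
    have h3 : n * p - √n ≤ (⌈n * p - √n⌉₊ : ℝ) := Nat.le_ceil _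
    rcases le_total ⌈n * p - √n⌉₊ (⌊n * p + √n⌋₊ + 1) with h | h
    · have h4 : (I.card : ℝ) ≤ ((⌊n * p + √n⌋₊ + 1 - ⌈n * p - √n⌉₊ : ℕ) : ℝ) := by
        exact_mod_cast h1
      rw [Nat.cast_sub h] at h4
      push_cast at h4
      linarith
    · rw [Nat.sub_eq_zero_of_le h] at h1
      have : I.card = 0 := by omega
      rw [this]
      push_cast
      positivity
  have hI0 : 0 < (I.card : ℝ) := by
    rcases I.eq_empty_or_nonempty with h | h
    · rw [h] at hmass
      norm_num at hmass
    · exact_mod_cast h.card_pos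
  calc (3 / 4 : ℝ) ^ (e + 1) / (3 * √n) ^ e
      ≤ (∑ k ∈ I, binomialWeight p n k) ^ (e + 1) / (I.card : ℝ) ^ e := by gcongr
    _ ≤ ∑ k ∈ I, binomialWeight p n k ^ (e + 1) := pow_sum_div_card_le_sum_pow (fun k _ => hb k) e
    _ ≤ _ := sum_le_sum_of_subset_of_nonneg (filter_subset _ _)
            fun k _ _ => pow_nonneg (hb k) _

/-! ### Independence over disjoint blocks of indices -/

theorem measure_biInter_of_iIndep {Ω ι κ : Type*} {mΩ : MeasurableSpace Ω} {μ : Measure Ω}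
    [IsProbabilityMeasure μ] {F : ι → MeasurableSpace Ω} (hle : ∀ n, F n ≤ mΩ) (h : iIndep F μ)
    {S : κ → Set ι} (hS : Pairwise fun i j => Disjoint (S i) (S j)) {B : κ → Set Ω}
    (hB : ∀ j, MeasurableSet[⨆ n ∈ S j, F n] (B j)) (J : Finset κ) :
    μ (⋂ j ∈ J, B j) = ∏ j ∈ J, μ (B j) := by
  classical
  induction J using Finset.induction_on with
  | empty => simp
  | insert j J hj ih =>
    have hdisj : Disjoint (S j) (⋃ i ∈ J, S i) := by
      rw [Set.disjoint_iUnion₂_right]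
      intro i hi
      exact hS fun hij => hj (hij ▸ hi)
    have hind := indep_iSup_of_disjoint hle h hdisj
    rw [set_biInter_insert, prod_insert hj, ← ih]
    refine (Indep_iff _ _ μ).1 hind _ _ (hB j) ?_
    refine Finset.measurableSet_biInter J fun i hi => ?_
    have : (⨆ n ∈ S i, F n) ≤ ⨆ n ∈ ⋃ i ∈ J, S i, F n :=
      biSup_mono fun n hn => Set.mem_biUnion (Finset.mem_coe.2 hi) hn
    exact this _ (hB i)

/-! ### Measurability of the chain and of the arrival counts -/

/-- The number of arrivals at queue `i` in the slots of `[s, t)`. -/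
def arrivals {d : ℕ} {Ω : Type*} (a : ℕ → Fin d → Ω → Bool) (i : Fin d) (s t : ℕ) (ω : Ω) : ℕ :=
  ∑ u ∈ Ico s t, (a u i ω).toNat

/-- The number of slots of `[s, t)` in which the server is available. -/
def services {Ω : Type*} (m : ℕ → Ω → Bool) (s t : ℕ) (ω : Ω) : ℕ :=
  ∑ u ∈ Ico s t, (m u ω).toNat

section Measurable

variable {d : ℕ} {Ω : Type*} {mΩ : MeasurableSpace Ω} {a : ℕ → Fin d → Ω → Bool} {m : ℕ → Ω → Bool}

theorem measurable_arrivals {i : Fin d} {t : ℕ} (ha : ∀ u < t, Measurable (a u i)) (s : ℕ) :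
    Measurable (arrivals a i s t) := by
  refine Finset.measurable_sum _ fun u hu => ?_
  exact (measurable_of_countable Bool.toNat).comp (ha u (mem_Ico.1 hu).2)

theorem measurable_services {t : ℕ} (hm : ∀ u < t, Measurable (m u)) (s : ℕ) :
    Measurable (services m s t) := by
  refine Finset.measurable_sum _ fun u hu => ?_
  exact (measurable_of_countable Bool.toNat).comp (hm u (mem_Ico.1 hu).2)

theorem measurable_queue (x : Fin d → ℕ) {t : ℕ} (ha : ∀ u < t, ∀ i, Measurable (a u i))
    (hm : ∀ u < t, Measurable (m u)) : Measurable (queue a m x t) := by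
  induction t with
  | zero => exact measurable_const
  | succ t ih =>
    have h1 := ih (fun u hu => ha u (by omega)) (fun u hu => hm u (by omega))
    have h2 : Measurable fun ω => (queue a m x t ω, (fun i => a t i ω), m t ω) :=
      h1.prodMk ((measurable_pi_iff.2 fun i => ha t (by omega) i).prodMk (hm t (by omega)))
    have h3 : Measurable fun z : (Fin d → ℕ) × (Fin d → Bool) × Bool => step z.1 z.2.1 z.2.2 :=
      measurable_of_countable _
    exact h3.comp h2

end Measurable

/-! ### Canonical form of the input -/

section Input

variable {d : ℕ} {Ω : Type*} {a : ℕ → Fin d → Ω → Bool} {m : ℕ → Ω → Bool}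

/-- The input as one family of random bits. -/
def bits (a : ℕ → Fin d → Ω → Bool) (m : ℕ → Ω → Bool) : (ℕ × Fin d) ⊕ ℕ → Ω → Bool :=
  Sum.elim (fun k : ℕ × Fin d => a k.1 k.2) m

/-- The time slot to which an input bit belongs. -/
def slot : (ℕ × Fin d) ⊕ ℕ → ℕ := Sum.elim (fun k => k.1) fun t => t

/-- Translation of the input indices by `k` slots. -/
def shiftIndex (k : ℕ) : (ℕ × Fin d) ⊕ ℕ → (ℕ × Fin d) ⊕ ℕ :=
  Sum.map (fun z => (k + z.1, z.2)) fun t => k + t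

/-- The sigma-algebra generated by the input bits with index in `S`. -/
abbrev bitsAlgebra (a : ℕ → Fin d → Ω → Bool) (m : ℕ → Ω → Bool) (S : Set ((ℕ × Fin d) ⊕ ℕ)) :
    MeasurableSpace Ω :=
  ⨆ n ∈ S, MeasurableSpace.comap (bits a m n) inferInstance

theorem measurable_bits_bitsAlgebra {S : Set ((ℕ × Fin d) ⊕ ℕ)} {n : (ℕ × Fin d) ⊕ ℕ}
    (hn : n ∈ S) : Measurable[bitsAlgebra a m S] (bits a m n) := by
  have : MeasurableSpace.comap (bits a m n) inferInstance ≤ bitsAlgebra a m S :=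
    le_biSup (fun n => MeasurableSpace.comap (bits a m n) inferInstance) hn
  exact fun s hs => this _ ⟨s, hs, rfl⟩

/-- The queue as a function of a deterministic input sequence. -/
def inputQueue (x : Fin d → ℕ) (t : ℕ) (z : (ℕ × Fin d) ⊕ ℕ → Bool) : Fin d → ℕ :=
  queue (fun s i (z : (ℕ × Fin d) ⊕ ℕ → Bool) => z (Sum.inl (s, i))) (fun s z => z (Sum.inr s)) x t z

theorem inputQueue_bits (x : Fin d → ℕ) (t : ℕ) (ω : Ω) :
    inputQueue x t (fun n => bits a m n ω) = queue a m x t ω := by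
  induction t with
  | zero => rfl
  | succ t ih =>
    unfold inputQueue queue
    unfold inputQueue at ih
    rw [ih]
    rfl

/-- This flow property is the deterministic half of the Markov property; the probabilistic half is
the shift invariance `measure_bits_shift`. -/
theorem inputQueue_shift (x : Fin d → ℕ) (k t : ℕ) (ω : Ω) :
    inputQueue (queue a m x k ω) t (fun n => bits a m (shiftIndex k n) ω) =
      queue a m x (k + t) ω := by
  induction t with
  | zero => rfl
  | succ t ih =>
    rw [← add_assoc]
    unfold inputQueue queue
    unfold inputQueue at ih
    rw [ih]
    rfl

theorem measurable_inputQueue (x : Fin d → ℕ) (t : ℕ) : Measurable (inputQueue x t) :=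
  measurable_queue x (fun _ _ _ => measurable_pi_apply _) fun _ _ => measurable_pi_apply _

/-! ### Shift invariance and the Markov property -/

namespace IsBatchInput

variable [MeasurableSpace Ω] {μ : Measure Ω} {p mbar : ℝ} (hinput : IsBatchInput μ p mbar a m)
include hinput

theorem measurable_bits (n : (ℕ × Fin d) ⊕ ℕ) : Measurable (bits a m n) := by
  rcases n with ⟨t, i⟩ | t
  · exact hinput.measurable_arrival t i
  · exact hinput.measurable_service t

theorem measurable_queue (x : Fin d → ℕ) (t : ℕ) : Measurable (queue a m x t) :=
  SyncQueues.measurable_queue x (fun u _ i => hinput.measurable_arrival u i)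
    fun u _ => hinput.measurable_service u

theorem measurableSet_queue_eq (x y : Fin d → ℕ) (t : ℕ) :
    MeasurableSet {ω | queue a m x t ω = y} :=
  hinput.measurable_queue x t (measurableSet_singleton y)

theorem iIndep_bits : iIndep (fun n => MeasurableSpace.comap (bits a m n) inferInstance) μ :=
  hinput.indep

theorem comap_bits_le (n : (ℕ × Fin d) ⊕ ℕ) :
    MeasurableSpace.comap (bits a m n) inferInstance ≤ (inferInstance : MeasurableSpace Ω) :=
  (hinput.measurable_bits n).comap_le

theorem measureReal_inter {S T : Set ((ℕ × Fin d) ⊕ ℕ)} (hST : Disjoint S T) {B C : Set Ω}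
    (hB : MeasurableSet[bitsAlgebra a m S] B) (hC : MeasurableSet[bitsAlgebra a m T] C) :
    μ.real (B ∩ C) = μ.real B * μ.real C := by
  have h := indep_iSup_of_disjoint hinput.comap_bits_le hinput.iIndep_bits hST
  rw [measureReal_def, (Indep_iff _ _ μ).1 h B C hB hC, ENNReal.toReal_mul]
  rfl

variable [IsProbabilityMeasure μ]

theorem map_bits_shift (k : ℕ) (n : (ℕ × Fin d) ⊕ ℕ) :
    μ.map (bits a m (shiftIndex k n)) = μ.map (bits a m n) := by
  have h1 := hinput.measurable_bits
  have htrue : ∀ n : (ℕ × Fin d) ⊕ ℕ, μ.map (bits a m n) {true} =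
      Sum.elim (fun _ => ENNReal.ofReal p) (fun _ => ENNReal.ofReal mbar) n := by
    rintro (⟨t, i⟩ | t)
    · rw [Measure.map_apply (h1 _) (measurableSet_singleton _)]
      exact hinput.prob_arrival t i
    · rw [Measure.map_apply (h1 _) (measurableSet_singleton _)]
      exact hinput.prob_service t
  have heq : μ.map (bits a m (shiftIndex k n)) {true} = μ.map (bits a m n) {true} := by
    rw [htrue, htrue]
    rcases n with n | n <;> rfl
  have i1 := Measure.isProbabilityMeasure_map (μ := μ) (h1 n).aemeasurable
  have i2 := Measure.isProbabilityMeasure_map (μ := μ) (h1 (shiftIndex k n)).aemeasurable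
  refine Measure.ext_of_singleton fun b => ?_
  cases b
  · have hc : ({false} : Set Bool) = {true}ᶜ := by ext b; cases b <;> simp
    rw [hc, prob_compl_eq_one_sub (measurableSet_singleton _),
      prob_compl_eq_one_sub (measurableSet_singleton _), heq]
  · exact heq

/-- By independence the joint law is the product of the marginals, and an injective shift that
preserves the kind of each bit leaves these unchanged. -/
theorem measure_bits_shift (k : ℕ) {Q : Set ((ℕ × Fin d) ⊕ ℕ → Bool)} (hQ : MeasurableSet Q) :
    μ {ω | (fun n => bits a m (shiftIndex k n) ω) ∈ Q} = μ {ω | (fun n => bits a m n ω) ∈ Q} := by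
  have h1 := hinput.measurable_bits
  have hinj : Function.Injective (shiftIndex (d := d) k) :=
    Function.Injective.sumMap (fun x y h => by simp_all [Prod.ext_iff]) fun x y h => by simpa using h
  have e1 := iIndepFun.map_fun_eq_infinitePi_map h1 hinput.indep
  have e2 := iIndepFun.map_fun_eq_infinitePi_map (fun n => h1 (shiftIndex k n))
    (iIndepFun.precomp hinj hinput.indep)
  simp only [hinput.map_bits_shift k] at e2
  have e3 := e2.trans e1.symm
  have e4 := congrArg (fun ν => ν Q) e3
  rwa [Measure.map_apply (measurable_pi_iff.2 fun n => h1 _) hQ,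
    Measure.map_apply (measurable_pi_iff.2 fun n => h1 _) hQ] at e4

/-- The Markov property: given the state at time `k`, the future of the chain is distributed as the
chain started there. -/
theorem markov (x y : Fin d → ℕ) (k : ℕ) {R : Set (ℕ → Fin d → ℕ)} (hR : MeasurableSet R) :
    μ.real {ω | queue a m x k ω = y ∧ (fun j => queue a m x (k + j) ω) ∈ R} =
      μ.real {ω | queue a m x k ω = y} * μ.real {ω | (fun j => queue a m y j ω) ∈ R} := by
  have hQ : MeasurableSet {z | (fun j => inputQueue y j z) ∈ R} :=
    (measurable_pi_iff.2 fun j => measurable_inputQueue y j) hR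
  -- Once the state at time `k` is fixed to be `y`, the future depends only on slots from `k` on,
  -- the present only on earlier slots.
  have h1 : {ω | queue a m x k ω = y ∧ (fun j => queue a m x (k + j) ω) ∈ R} =
      {ω | queue a m x k ω = y} ∩
        {ω | (fun n => bits a m (shiftIndex k n) ω) ∈ {z | (fun j => inputQueue y j z) ∈ R}} := by
    ext ω
    simp only [Set.mem_ofPred_eq, Set.mem_inter_iff]
    refine and_congr_right fun h => ?_
    simp only [← h, inputQueue_shift]
  have hdisj : Disjoint {n : (ℕ × Fin d) ⊕ ℕ | slot n < k} {n | k ≤ slot n} :=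
    Set.disjoint_left.2 fun n (h1 : slot n < k) (h2 : k ≤ slot n) => absurd h1 (not_lt.2 h2)
  rw [h1, hinput.measureReal_inter hdisj, measureReal_def μ
    {ω | (fun n => bits a m (shiftIndex k n) ω) ∈ {z | (fun j => inputQueue y j z) ∈ R}},
    hinput.measure_bits_shift k hQ]
  · simp only [Set.mem_ofPred_eq, inputQueue_bits]
    rfl
  · have : Measurable[bitsAlgebra a m {n | slot n < k}] (queue a m x k) :=
      SyncQueues.measurable_queue x
        (fun u hu i => measurable_bits_bitsAlgebra (n := Sum.inl (u, i)) hu)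
        (fun u hu => measurable_bits_bitsAlgebra (n := Sum.inr u) hu)
    exact this (measurableSet_singleton y)
  · have : Measurable[bitsAlgebra a m {n | k ≤ slot n}]
        (fun ω n => bits a m (shiftIndex k n) ω) := by
      refine (@measurable_pi_iff _ _ _ (_) _ _).2 fun n => measurable_bits_bitsAlgebra ?_
      rcases n with n | n <;> simp [shiftIndex, slot]
    exact this hQ

theorem measureReal_queue_add (x y z : Fin d → ℕ) (k t : ℕ) :
    μ.real {ω | queue a m x k ω = y} * μ.real {ω | queue a m y t ω = z} ≤
      μ.real {ω | queue a m x (k + t) ω = z} := by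
  have hR : MeasurableSet {f : ℕ → Fin d → ℕ | f t = z} := by
    have : Measurable fun f : ℕ → Fin d → ℕ => f t := measurable_pi_apply t
    exact this (measurableSet_singleton z)
  have h := hinput.markov x y k hR
  simp only [Set.mem_ofPred_eq] at h
  rw [← h]
  exact measureReal_mono fun ω hω => hω.2

end IsBatchInput

end Input

/-! ### Last-exit decomposition and recurrence criteria -/

section Renewal

variable {d : ℕ} {Ω : Type*} {a : ℕ → Fin d → Ω → Bool} {m : ℕ → Ω → Bool}

/-- The event that the chain started in `x` does not return to `x` until time `j`. -/
def noReturn (a : ℕ → Fin d → Ω → Bool) (m : ℕ → Ω → Bool) (x : Fin d → ℕ) (j : ℕ) : Set Ω :=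
  {ω | ∀ i, 1 ≤ i → i ≤ j → queue a m x i ω ≠ x}

theorem noReturn_antitone (x : Fin d → ℕ) : Antitone (noReturn a m x) :=
  fun _ _ hij _ hω l hl1 hl2 => hω l hl1 (hl2.trans hij)

theorem compl_returnEvent (x : Fin d → ℕ) : (returnEvent a m x)ᶜ = ⋂ j, noReturn a m x j := by
  ext ω
  simp only [returnEvent, noReturn, Set.mem_compl_iff, Set.mem_ofPred_eq, Set.mem_iInter, not_exists,
    not_and]
  exact ⟨fun h _ i hi _ => h i hi, fun h i hi => h i i hi le_rfl⟩

theorem measurableSet_avoid (x : Fin d → ℕ) (j : ℕ) :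
    MeasurableSet {f : ℕ → Fin d → ℕ | ∀ i, 1 ≤ i → i ≤ j → f i ≠ x} := by
  have h : {f : ℕ → Fin d → ℕ | ∀ i, 1 ≤ i → i ≤ j → f i ≠ x} =
      ⋂ (i : ℕ) (_ : 1 ≤ i) (_ : i ≤ j), (fun f : ℕ → Fin d → ℕ => f i) ⁻¹' {x}ᶜ := by
    ext f
    simp
  rw [h]
  refine .iInter fun i => .iInter fun _ => .iInter fun _ => ?_
  exact measurable_pi_apply i (measurableSet_singleton x).compl

namespace IsBatchInput

variable [MeasurableSpace Ω] {μ : Measure Ω} {p mbar : ℝ} (hinput : IsBatchInput μ p mbar a m)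
include hinput

theorem measurableSet_noReturn (x : Fin d → ℕ) (j : ℕ) : MeasurableSet (noReturn a m x j) :=
  (measurable_pi_iff.2 fun i => hinput.measurable_queue x i) (measurableSet_avoid x j)

theorem measurableSet_returnEvent (x : Fin d → ℕ) : MeasurableSet (returnEvent a m x) := by
  rw [← compl_compl (returnEvent a m x), compl_returnEvent]
  exact (MeasurableSet.iInter fun j => hinput.measurableSet_noReturn x j).compl

variable [IsProbabilityMeasure μ]

/-- Decomposition of the probability space according to the last visit to `x` before time `n`. -/
theorem last_exit (x : Fin d → ℕ) (n : ℕ) :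
    ∑ k ∈ range (n + 1), μ.real {ω | queue a m x k ω = x} * μ.real (noReturn a m x (n - k)) = 1 := by
  set E : ℕ → Set Ω := fun k => {ω | queue a m x k ω = x ∧
    (fun j => queue a m x (k + j) ω) ∈ {f : ℕ → Fin d → ℕ | ∀ i, 1 ≤ i → i ≤ n - k → f i ≠ x}}
    with hE
  have h1 : ∀ k, μ.real {ω | queue a m x k ω = x} * μ.real (noReturn a m x (n - k)) =
      μ.real (E k) := fun k => (hinput.markov x x k (measurableSet_avoid x (n - k))).symm
  have hEm : ∀ k, MeasurableSet (E k) := fun k =>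
    (hinput.measurableSet_queue_eq x x k).inter
      ((measurable_pi_iff.2 fun j => hinput.measurable_queue x (k + j))
        (measurableSet_avoid x (n - k)))
  have hdisj : ∀ k l, k < l → l ≤ n → Disjoint (E k) (E l) := by
    intro k l hkl hl
    refine Set.disjoint_left.2 fun ω hk hll => ?_
    refine hk.2 (l - k) (by omega) (by omega) ?_
    have : k + (l - k) = l := by omega
    simp only [this]
    exact hll.1
  simp only [h1]
  rw [← measureReal_biUnion_finset _ fun k _ => hEm k]
  · rw [← probReal_univ (μ := μ)]
    congr 1
    refine Set.eq_univ_of_forall fun ω => ?_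
    classical
    -- The last visit exists because time 0 is itself a visit.
    set k := Nat.findGreatest (fun k => queue a m x k ω = x) n with hk
    have hkn : k ≤ n := Nat.findGreatest_le n
    refine Set.mem_biUnion (x := k) (by simpa using Nat.lt_succ_of_le hkn) ⟨?_, ?_⟩
    · exact Nat.findGreatest_spec (P := fun k => queue a m x k ω = x) (Nat.zero_le n) rfl
    · intro i hi1 hi2
      exact Nat.findGreatest_is_greatest (P := fun k => queue a m x k ω = x)
        (show k < k + i by omega) (by omega)
  · intro k hk l hl hkl
    have hk' : k ≤ n := by simpa [Nat.lt_succ_iff] using hk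
    have hl' : l ≤ n := by simpa [Nat.lt_succ_iff] using hl
    rcases lt_or_gt_of_ne hkl with h | h
    · exact hdisj k l h hl'
    · exact (hdisj l k h hk').symm

/-- Otherwise the escape probability ε > 0 bounds every factor `noReturn` in `last_exit` from below,
so the sum of the visit probabilities is at most 1/ε. -/
theorem measure_returnEvent_eq_one {x : Fin d → ℕ}
    (h : ¬ Summable fun k => μ.real {ω | queue a m x k ω = x}) : μ (returnEvent a m x) = 1 := by
  have hle : ∀ j, μ.real (returnEvent a m x)ᶜ ≤ μ.real (noReturn a m x j) := fun j => by
    rw [compl_returnEvent]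
    exact measureReal_mono (Set.iInter_subset _ j)
  have hzero : μ.real (returnEvent a m x)ᶜ = 0 := by
    by_contra hne
    have hpos : 0 < μ.real (returnEvent a m x)ᶜ := lt_of_le_of_ne measureReal_nonneg (Ne.symm hne)
    refine h (summable_of_sum_range_le (c := 1 / μ.real (returnEvent a m x)ᶜ)
      (fun _ => measureReal_nonneg) fun n => ?_)
    rw [le_div_iff₀ hpos, ← hinput.last_exit x n, sum_mul]
    refine (sum_le_sum fun k _ => mul_le_mul_of_nonneg_left (hle (n - k)) measureReal_nonneg).trans ?_
    exact sum_le_sum_of_subset_of_nonneg (range_subset_range.2 n.le_succ)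
      fun _ _ _ => mul_nonneg measureReal_nonneg measureReal_nonneg
  rw [measureReal_eq_zero_iff] at hzero
  exact (prob_compl_eq_zero_iff (hinput.measurableSet_returnEvent x)).1 hzero

/-- If return were certain, `noReturn` would have vanishing probability, and the convolution in
`last_exit` would tend to 0 instead of being 1. -/
theorem measure_returnEvent_lt_one {x : Fin d → ℕ}
    (h : Summable fun k => μ.real {ω | queue a m x k ω = x}) : μ (returnEvent a m x) < 1 := by
  refine lt_of_le_of_ne prob_le_one fun hone => ?_
  have h0 := (prob_compl_eq_zero_iff (hinput.measurableSet_returnEvent x)).2 hone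
  have hlim : Tendsto (fun j => μ.real (noReturn a m x j)) atTop (𝓝 0) := by
    have h1 := tendsto_measure_iInter_atTop (μ := μ)
      (fun j => (hinput.measurableSet_noReturn x j).nullMeasurableSet) (noReturn_antitone x)
      ⟨0, measure_ne_top _ _⟩
    rw [← compl_returnEvent, h0] at h1
    exact (ENNReal.tendsto_toReal ENNReal.zero_ne_top).comp h1
  have h2 := tendsto_sum_mul_sub_zero h (fun _ => measureReal_nonneg) hlim fun n => by
    rw [abs_of_nonneg measureReal_nonneg]
    exact measureReal_le_one
  simp only [hinput.last_exit] at h2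
  exact one_ne_zero (tendsto_nhds_unique tendsto_const_nhds h2)

theorem not_summable_measureReal_noReturn {x : Fin d → ℕ}
    (h : Tendsto (fun k => μ.real {ω | queue a m x k ω = x}) atTop (𝓝 0)) :
    ¬ Summable fun j => μ.real (noReturn a m x j) := by
  intro hs
  have h2 := tendsto_sum_mul_sub_zero hs (fun _ => measureReal_nonneg) h fun n => by
    rw [abs_of_nonneg measureReal_nonneg]
    exact measureReal_le_one
  refine one_ne_zero (tendsto_nhds_unique tendsto_const_nhds (h2.congr fun n => ?_))
  rw [← hinput.last_exit x n, ← sum_range_reflect]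
  refine sum_congr rfl fun k hk => ?_
  have hk' : k ≤ n := by simpa [Nat.lt_succ_iff] using hk
  rw [mul_comm, show n + 1 - 1 - k = n - k by omega, show n - (n - k) = k by omega]

/-- The mean return time is at least the tail sum of the `noReturn` probabilities. That sum diverges
by the same convolution argument with the two factors exchanged. -/
theorem lintegral_returnTime_eq_top {x : Fin d → ℕ}
    (h : Tendsto (fun k => μ.real {ω | queue a m x k ω = x}) atTop (𝓝 0)) :
    ∫⁻ ω, returnTime a m x ω ∂μ = ⊤ := by
  have hsum : ∑' j, μ (noReturn a m x j) = ⊤ := by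
    by_contra hne
    exact hinput.not_summable_measureReal_noReturn h (ENNReal.summable_toReal hne)
  rw [eq_top_iff, ← hsum]
  have h1 : ∀ j, μ (noReturn a m x j) = ∫⁻ ω, (noReturn a m x j).indicator 1 ω ∂μ := fun j =>
    (lintegral_indicator_one (hinput.measurableSet_noReturn x j)).symm
  simp only [h1]
  rw [← lintegral_tsum fun j =>
    (measurable_one.indicator (hinput.measurableSet_noReturn x j)).aemeasurable]
  refine lintegral_mono fun ω => ?_
  refine le_iInf₂ fun t ht => ?_
  rw [tsum_eq_sum (s := range t)]
  · calc ∑ j ∈ range t, (noReturn a m x j).indicator (1 : Ω → ℝ≥0∞) ω ≤ ∑ _j ∈ range t, 1 :=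
          sum_le_sum fun j _ => Set.indicator_le_self' (fun _ _ => zero_le) ω
      _ = t := by simp
  · intro j hj
    refine Set.indicator_of_notMem (fun hω => ?_) _
    exact hω t ht.1 (by simpa using hj) ht.2

end IsBatchInput

end Renewal

/-! ### Equal arrival counts and a Hoeffding bound -/

section Arrivals

variable {d : ℕ} {Ω : Type*} {a : ℕ → Fin d → Ω → Bool} {m : ℕ → Ω → Bool}

theorem arrivals_le (i : Fin d) (t : ℕ) (ω : Ω) : arrivals a i 0 t ω ≤ t := by
  unfold arrivals
  calc _ ≤ ∑ _u ∈ Ico 0 t, 1 := sum_le_sum fun u _ => Bool.toNat_le _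
    _ = t := by simp

theorem arrivals_succ {s t : ℕ} (h : s ≤ t) (i : Fin d) (ω : Ω) :
    arrivals a i s (t + 1) ω = arrivals a i s t ω + (a t i ω).toNat :=
  sum_Ico_succ_top h _

theorem services_succ {s t : ℕ} (h : s ≤ t) (ω : Ω) :
    services m s (t + 1) ω = services m s t ω + (m t ω).toNat :=
  sum_Ico_succ_top h _

/-- The event that all queues have had the same number of arrivals by time `t`. -/
def balanced (a : ℕ → Fin d → Ω → Bool) (t : ℕ) : Set Ω :=
  {ω | ∀ i j, arrivals a i 0 t ω = arrivals a j 0 t ω}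

namespace IsBatchInput

variable [MeasurableSpace Ω] {μ : Measure Ω} {p mbar : ℝ}
  (hinput : IsBatchInput μ p mbar a m)
include hinput

theorem measurable_arrivals (i : Fin d) (s t : ℕ) : Measurable (arrivals a i s t) :=
  SyncQueues.measurable_arrivals (fun u _ => hinput.measurable_arrival u i) s

theorem measurable_services (s t : ℕ) : Measurable (services m s t) :=
  SyncQueues.measurable_services (fun u _ => hinput.measurable_service u) s

theorem measurableSet_arrivals_eq (i : Fin d) (s t k : ℕ) :
    MeasurableSet {ω | arrivals a i s t ω = k} :=
  hinput.measurable_arrivals i s t (measurableSet_singleton k)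

theorem measureReal_bits_true (hp : 0 ≤ p) (hm : 0 ≤ mbar) (n : (ℕ × Fin d) ⊕ ℕ) :
    μ.real {ω | bits a m n ω = true} = Sum.elim (fun _ => p) (fun _ => mbar) n := by
  rw [measureReal_def]
  rcases n with ⟨t, i⟩ | t
  · exact (congrArg ENNReal.toReal (hinput.prob_arrival t i)).trans (ENNReal.toReal_ofReal hp)
  · exact (congrArg ENNReal.toReal (hinput.prob_service t)).trans (ENNReal.toReal_ofReal hm)

theorem integral_bits (hp : 0 ≤ p) (hm : 0 ≤ mbar) (n : (ℕ × Fin d) ⊕ ℕ) :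
    ∫ ω, ((bits a m n ω).toNat : ℝ) ∂μ = Sum.elim (fun _ => p) (fun _ => mbar) n := by
  have h1 : (fun ω => ((bits a m n ω).toNat : ℝ)) = {ω | bits a m n ω = true}.indicator 1 := by
    ext ω
    by_cases h : bits a m n ω = true <;> simp [h]
  have h2 : MeasurableSet {ω | bits a m n ω = true} :=
    hinput.measurable_bits n (measurableSet_singleton true)
  rw [h1, integral_indicator_one h2, hinput.measureReal_bits_true hp hm]

variable [IsProbabilityMeasure μ]

theorem measureReal_arrival (hp : 0 ≤ p) (t : ℕ) (i : Fin d) (b : Bool) :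
    μ.real {ω | a t i ω = b} = if b then p else 1 - p := by
  have h1 : μ.real {ω | a t i ω = true} = p := by
    rw [measureReal_def, hinput.prob_arrival, ENNReal.toReal_ofReal hp]
  cases b
  · have h2 : {ω | a t i ω = false} = {ω | a t i ω = true}ᶜ := by
      ext ω
      simp
    have h3 : MeasurableSet {ω | a t i ω = true} :=
      hinput.measurable_arrival t i (measurableSet_singleton true)
    rw [h2, probReal_compl_eq_one_sub h3, h1]
    simp
  · simpa using h1

theorem measureReal_arrivals_eq_and (hp : 0 ≤ p) (i : Fin d) (t k : ℕ) (b : Bool) :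
    μ.real {ω | arrivals a i 0 t ω = k ∧ a t i ω = b} =
      μ.real {ω | arrivals a i 0 t ω = k} * if b then p else 1 - p := by
  rw [← hinput.measureReal_arrival hp t i b]
  have hdisj : Disjoint {n : (ℕ × Fin d) ⊕ ℕ | slot n < t} {n | slot n = t} :=
    Set.disjoint_left.2 fun n (h1 : slot n < t) (h2 : slot n = t) => h1.ne h2
  refine hinput.measureReal_inter hdisj ?_ ?_
  · have : Measurable[bitsAlgebra a m {n | slot n < t}] (arrivals a i 0 t) :=
      SyncQueues.measurable_arrivals
        (fun u hu => measurable_bits_bitsAlgebra (n := Sum.inl (u, i)) hu) 0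
    exact this (measurableSet_singleton k)
  · exact measurable_bits_bitsAlgebra (n := Sum.inl (t, i)) (S := {n | slot n = t}) rfl
      (measurableSet_singleton b)

theorem measureReal_arrivals_eq (hp : 0 ≤ p) (i : Fin d) (t k : ℕ) :
    μ.real {ω | arrivals a i 0 t ω = k} = binomialWeight p t k := by
  induction t generalizing k with
  | zero => cases k <;> simp [arrivals, binomialWeight]
  | succ t ih =>
    have hmeas : ∀ k b, MeasurableSet {ω | arrivals a i 0 t ω = k ∧ a t i ω = b} := fun k b =>
      (hinput.measurableSet_arrivals_eq i 0 t k).inter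
        (hinput.measurable_arrival t i (measurableSet_singleton b))
    cases k with
    | zero =>
      have h1 : {ω | arrivals a i 0 (t + 1) ω = 0} =
          {ω | arrivals a i 0 t ω = 0 ∧ a t i ω = false} := by
        ext ω
        simp only [arrivals_succ (Nat.zero_le t), Set.mem_ofPred_eq]
        cases a t i ω <;> simp
      rw [h1, hinput.measureReal_arrivals_eq_and hp, ih, binomialWeight_succ_zero]
      simp [mul_comm]
    | succ k =>
      have h1 : {ω | arrivals a i 0 (t + 1) ω = k + 1} =
          {ω | arrivals a i 0 t ω = k + 1 ∧ a t i ω = false} ∪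
            {ω | arrivals a i 0 t ω = k ∧ a t i ω = true} := by
        ext ω
        simp only [arrivals_succ (Nat.zero_le t), Set.mem_ofPred_eq, Set.mem_union]
        cases a t i ω <;> simp
      rw [h1, measureReal_union _ (hmeas _ _), hinput.measureReal_arrivals_eq_and hp,
        hinput.measureReal_arrivals_eq_and hp, ih, ih, binomialWeight_succ_succ]
      · simp [mul_comm]
      · refine Set.disjoint_left.2 fun ω h1 h2 => ?_
        have := h1.2.symm.trans h2.2
        simp at this

/-- If an event `G` depends on queue `i₀` and the server only, then the probability of `G` and
equal numbers of arrivals factors up to the maximal binomial weight. -/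
theorem measureReal_balanced_inter_le (hp : 0 ≤ p) (hp1 : p ≤ 1) {t : ℕ} {M : ℝ}
    (hM : ∀ k, binomialWeight p t k ≤ M) (i₀ : Fin d) {G : Set Ω}
    (hG : MeasurableSet[bitsAlgebra a m {n | Sum.elim (fun k => k.2) (fun _ => i₀) n = i₀}] G) :
    μ.real (balanced a t ∩ G) ≤ M ^ (d - 1) * μ.real G := by
  classical
  have hM0 : 0 ≤ M := (binomialWeight_nonneg hp hp1 t 0).trans (hM 0)
  -- Server bits are assigned to `i₀`, so that `G` and the arrivals at `i₀` share one block,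
  -- independent of the other queues.
  set owner : (ℕ × Fin d) ⊕ ℕ → Fin d := Sum.elim (fun k => k.2) (fun _ => i₀) with howner
  set B : ℕ → Fin d → Set Ω := fun k j =>
    if j = i₀ then {ω | arrivals a j 0 t ω = k} ∩ G else {ω | arrivals a j 0 t ω = k} with hB
  have hAm : ∀ k j, MeasurableSet[bitsAlgebra a m {n | owner n = j}]
      {ω | arrivals a j 0 t ω = k} := by
    intro k j
    have : Measurable[bitsAlgebra a m {n | owner n = j}] (arrivals a j 0 t) :=
      SyncQueues.measurable_arrivals
        (fun u _ => measurable_bits_bitsAlgebra (n := Sum.inl (u, j)) rfl) 0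
    exact this (measurableSet_singleton k)
  have hBm : ∀ k j, MeasurableSet[bitsAlgebra a m {n | owner n = j}] (B k j) := by
    intro k j
    by_cases hj : j = i₀
    · simp only [hB, if_pos hj]
      subst hj
      exact MeasurableSet.inter (hAm k j) hG
    · simp only [hB, if_neg hj]
      exact hAm k j
  have hdisj : Pairwise fun i j : Fin d => Disjoint {n | owner n = i} {n | owner n = j} :=
    fun i j hij => Set.disjoint_left.2 fun n (h1 : owner n = i) (h2 : owner n = j) =>
      hij (h1.symm.trans h2)
  have hprod : ∀ k, μ.real (⋂ j ∈ univ, B k j) ≤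
      M ^ (d - 1) * μ.real ({ω | arrivals a i₀ 0 t ω = k} ∩ G) := by
    intro k
    rw [measureReal_def, measure_biInter_of_iIndep hinput.comap_bits_le hinput.iIndep_bits hdisj
      (hBm k) univ, ENNReal.toReal_prod, ← mul_prod_erase _ _ (mem_univ i₀), mul_comm]
    have h1 : (μ (B k i₀)).toReal = μ.real ({ω | arrivals a i₀ 0 t ω = k} ∩ G) := by
      simp [hB, measureReal_def]
    rw [h1]
    refine mul_le_mul_of_nonneg_right ?_ measureReal_nonneg
    have h2 : #(univ.erase i₀) = d - 1 := by simp
    rw [← h2, ← prod_const]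
    refine prod_le_prod (fun _ _ => ENNReal.toReal_nonneg) fun j hj => ?_
    have h3 : B k j = {ω | arrivals a j 0 t ω = k} := if_neg (ne_of_mem_erase hj)
    rw [h3]
    exact (hinput.measureReal_arrivals_eq hp j t k).le.trans (hM k)
  have hsub : balanced a t ∩ G ⊆ ⋃ k ∈ range (t + 1), ⋂ j ∈ univ, B k j := by
    intro ω hω
    refine Set.mem_biUnion (x := arrivals a i₀ 0 t ω)
      (by simpa [Nat.lt_succ_iff] using arrivals_le i₀ t ω) ?_
    refine Set.mem_iInter₂.2 fun j _ => ?_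
    by_cases hj : j = i₀
    · simp only [hB, if_pos hj]
      exact ⟨hω.1 j i₀, hω.2⟩
    · simp only [hB, if_neg hj]
      exact hω.1 j i₀
  have hle : bitsAlgebra a m {n | owner n = i₀} ≤ (inferInstance : MeasurableSpace Ω) :=
    iSup₂_le fun n _ => hinput.comap_bits_le n
  calc μ.real (balanced a t ∩ G)
      ≤ μ.real (⋃ k ∈ range (t + 1), ⋂ j ∈ univ, B k j) := measureReal_mono hsub (measure_ne_top _ _)
    _ ≤ ∑ k ∈ range (t + 1), μ.real (⋂ j ∈ univ, B k j) := measureReal_biUnion_finset_le _ _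
    _ ≤ ∑ k ∈ range (t + 1), M ^ (d - 1) * μ.real ({ω | arrivals a i₀ 0 t ω = k} ∩ G) :=
        sum_le_sum fun k _ => hprod k
    -- The factor of queue `i₀` is not bounded by `M`: its events for different `k` are disjoint
    -- parts of `G`, so they sum without loss.
    _ = M ^ (d - 1) * μ.real (⋃ k ∈ range (t + 1), {ω | arrivals a i₀ 0 t ω = k} ∩ G) := by
        rw [← mul_sum, measureReal_biUnion_finset]
        · intro k _ l _ hkl
          exact Set.disjoint_left.2 fun ω h1 h2 => hkl (h1.1.symm.trans h2.1)
        · exact fun k _ => (hinput.measurableSet_arrivals_eq i₀ 0 t k).inter (hle _ hG)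
    _ ≤ M ^ (d - 1) * μ.real G := by
        refine mul_le_mul_of_nonneg_left (measureReal_mono ?_) (pow_nonneg hM0 _)
        exact Set.iUnion₂_subset fun _ _ => Set.inter_subset_right

theorem measureReal_balanced_le (hp : 0 ≤ p) (hp1 : p ≤ 1) (hd : 0 < d) {t : ℕ} {M : ℝ}
    (hM : ∀ k, binomialWeight p t k ≤ M) : μ.real (balanced a t) ≤ M ^ (d - 1) := by
  have h := hinput.measureReal_balanced_inter_le hp hp1 hM ⟨0, hd⟩ (G := Set.univ) MeasurableSet.univ
  simpa using h

theorem sum_binomialWeight_pow_le (hp : 0 ≤ p) (hd : 0 < d) (t : ℕ) :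
    ∑ k ∈ range (t + 1), binomialWeight p t k ^ d ≤ μ.real (balanced a t) := by
  have hdisj : Pairwise fun i j : Fin d =>
      Disjoint {n : (ℕ × Fin d) ⊕ ℕ | ∃ u, n = Sum.inl (u, i)} {n | ∃ u, n = Sum.inl (u, j)} := by
    intro i j hij
    refine Set.disjoint_left.2 ?_
    rintro n ⟨u, rfl⟩ ⟨v, hv⟩
    exact hij (by simpa using congrArg (Sum.elim Prod.snd fun _ => i) hv)
  have hAm : ∀ k (j : Fin d), MeasurableSet[bitsAlgebra a m {n | ∃ u, n = Sum.inl (u, j)}]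
      {ω | arrivals a j 0 t ω = k} := by
    intro k j
    have : Measurable[bitsAlgebra a m {n | ∃ u, n = Sum.inl (u, j)}] (arrivals a j 0 t) :=
      SyncQueues.measurable_arrivals
        (fun u _ => measurable_bits_bitsAlgebra (n := Sum.inl (u, j))
          (S := {n | ∃ u, n = Sum.inl (u, j)}) ⟨u, rfl⟩) 0
    exact this (measurableSet_singleton k)
  have h1 : ∀ k, binomialWeight p t k ^ d =
      μ.real (⋂ j ∈ univ, {ω | arrivals a j 0 t ω = k}) := by
    intro k
    rw [measureReal_def, measure_biInter_of_iIndep hinput.comap_bits_le hinput.iIndep_bits hdisj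
      (hAm k) univ, ENNReal.toReal_prod]
    have h2 : ∀ j, (μ {ω | arrivals a j 0 t ω = k}).toReal = binomialWeight p t k :=
      fun j => hinput.measureReal_arrivals_eq hp j t k
    simp [h2]
  simp only [h1]
  rw [← measureReal_biUnion_finset]
  · refine measureReal_mono (Set.iUnion₂_subset fun k _ ω hω i j => ?_)
    have h2 := Set.mem_iInter₂.1 hω
    exact (h2 i (mem_univ i)).trans (h2 j (mem_univ j)).symm
  · intro k _ l _ hkl
    refine Set.disjoint_left.2 fun ω h2 h3 => hkl ?_
    exact (Set.mem_iInter₂.1 h2 ⟨0, hd⟩ (mem_univ _)).symm.trans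
      (Set.mem_iInter₂.1 h3 ⟨0, hd⟩ (mem_univ _))
  · exact fun k _ => Finset.measurableSet_biInter _ fun j _ =>
      hinput.measurableSet_arrivals_eq j 0 t k

theorem measureReal_services_add_le_arrivals (hp : 0 ≤ p) (hpm : p ≤ mbar) (i : Fin d) {s t : ℕ}
    (hst : s ≤ t) {K : ℕ} (hK : 0 < K) :
    μ.real {ω | services m s t ω + K ≤ arrivals a i s t ω} ≤
      Real.exp (-(K * (mbar - p))) * Real.exp (-(mbar - p) ^ 2) ^ (t - s) := by
  -- An empty interval is treated apart because the Hoeffding exponent divides by its length; there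
  -- the event is impossible as `K` is positive.
  rcases hst.eq_or_lt with rfl | hlt
  · have : {ω | services m s s ω + K ≤ arrivals a i s s ω} = ∅ := by
      ext ω
      simp [services, arrivals, hK.ne']
    rw [this]
    simp only [measureReal_empty]
    positivity
  have hmeas : ∀ n, Measurable fun ω => ((bits a m n ω).toNat : ℝ) := fun n =>
    (measurable_of_countable fun b : Bool => (b.toNat : ℝ)).comp (hinput.measurable_bits n)
  set g : (ℕ × Fin d) ⊕ ℕ → Bool → ℝ := fun n b =>
    Sum.elim (fun _ => (b.toNat : ℝ) - p) (fun _ => -((b.toNat : ℝ) - mbar)) n with hg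
  have hind : iIndepFun (fun n ω => g n (bits a m n ω)) μ :=
    iIndepFun.comp hinput.indep g fun n => measurable_of_countable _
  set T : Finset ((ℕ × Fin d) ⊕ ℕ) := (Ico s t ×ˢ {i}).disjSum (Ico s t) with hT
  have hsub : ∀ n ∈ T, HasSubgaussianMGF (fun ω => g n (bits a m n ω)) ((1 / 2) ^ 2) μ := by
    intro n _
    have h1 := hasSubgaussianMGF_of_mem_Icc (μ := μ) (a := 0) (b := 1)
      (hmeas n).aemeasurable (Eventually.of_forall fun ω => by
        cases bits a m n ω <;> simp)
    rw [hinput.integral_bits hp (hp.trans hpm)] at h1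
    have h2 : ((‖(1 : ℝ) - 0‖₊ / 2) ^ 2 : NNReal) = (1 / 2) ^ 2 := by simp
    rw [h2] at h1
    rcases n with n | n
    · exact h1
    · exact h1.neg
  set r : ℝ := ((t - s : ℕ) : ℝ) with hr
  have hr0 : 0 < r := by
    rw [hr]
    exact_mod_cast Nat.sub_pos_of_lt hlt
  have hδ : 0 ≤ mbar - p := sub_nonneg.2 hpm
  have hoeff := HasSubgaussianMGF.measure_sum_ge_le_of_iIndepFun hind hsub
    (ε := K + (mbar - p) * r) (by positivity)
  refine (measureReal_mono fun ω hω => ?_).trans (hoeff.trans ?_)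
  · have h1 : ∑ n ∈ T, g n (bits a m n ω) =
        ((arrivals a i s t ω : ℕ) : ℝ) - p * r - (services m s t ω - mbar * r) := by
      rw [hT, sum_disjSum, sum_product]
      simp only [sum_singleton, hg, bits, Sum.elim_inl, Sum.elim_inr, sum_neg_distrib,
        sum_sub_distrib, sum_const, Nat.card_Ico, card_singleton, arrivals, services, nsmul_eq_mul, ← hr]
      push_cast
      ring
    have h2 : ((services m s t ω : ℕ) : ℝ) + K ≤ (arrivals a i s t ω : ℕ) := by exact_mod_cast hω
    simp only [Set.mem_ofPred_eq]
    rw [h1]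
    linarith
  · rw [← Real.exp_nat_mul, ← Real.exp_add, Real.exp_le_exp]
    have h1 : ((∑ _n ∈ T, (1 / 2) ^ 2 : NNReal) : ℝ) = r / 2 := by
      have : #T = (t - s) + (t - s) := by simp [hT]
      rw [sum_const, this]
      push_cast
      rw [nsmul_eq_mul]
      push_cast
      rw [← hr]
      ring
    -- With δ = mbar - p, the exponent satisfies (K + δr)²/r ≥ 2Kδ + δ²r; one Kδ is given away.
    rw [h1, ← hr, show 2 * (r / 2) = r by ring, div_le_iff₀ hr0]
    have : 0 ≤ K * (mbar - p) * r := by positivity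
    nlinarith [sq_nonneg (K : ℝ)]

end IsBatchInput

end Arrivals

/-! ### Pathwise identities for the queues -/

section Paths

variable {d : ℕ} {Ω : Type*} {a : ℕ → Fin d → Ω → Bool} {m : ℕ → Ω → Bool}

/-- All queues lose the same number of customers in each slot, so departures cancel from
differences. -/
theorem queue_add_arrivals_add (x : Fin d → ℕ) (t : ℕ) (ω : Ω) (i j : Fin d) :
    queue a m x t ω i + arrivals a j 0 t ω + x j =
      queue a m x t ω j + arrivals a i 0 t ω + x i := by
  induction t with
  | zero => simp [queue, arrivals, add_comm]
  | succ t ih =>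
    have hi := control_le (queue a m x t ω) (m t ω) i
    have hj := control_le (queue a m x t ω) (m t ω) j
    rw [arrivals_succ (Nat.zero_le t), arrivals_succ (Nat.zero_le t)]
    simp only [queue, step]
    omega

theorem mem_balanced_of_queue_eq {x : Fin d → ℕ} {t : ℕ} {ω : Ω} (h : queue a m x t ω = x) :
    ω ∈ balanced a t := by
  intro i j
  have := queue_add_arrivals_add (a := a) (m := m) x t ω i j
  rw [h] at this
  omega

/-- The last time at which some queue was empty yields an explicit formula for that queue. -/
theorem exists_queue_zero_add_services (hd : 0 < d) (t : ℕ) (ω : Ω) :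
    ∃ i s, s ≤ t ∧ queue a m (fun _ => 0) t ω i + services m (s + 1) t ω = arrivals a i s t ω := by
  induction t with
  | zero => exact ⟨⟨0, hd⟩, 0, le_rfl, by simp [queue, services, arrivals]⟩
  | succ t ih =>
    by_cases h : ∀ i, 1 ≤ queue a m (fun _ => 0) t ω i
    · obtain ⟨i, s, hst, hs⟩ := ih
      have hlt : s < t := by
        -- If `s` were `t`, the formula would make queue `i` empty now.
        refine lt_of_le_of_ne hst ?_
        rintro rfl
        have := h i
        simp only [services, arrivals, Ico_self, sum_empty, Ico_eq_empty_of_le (Nat.le_succ s)] at hs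
        omega
      refine ⟨i, s, by omega, ?_⟩
      rw [arrivals_succ hst, services_succ (by omega)]
      have hi := control_le (queue a m (fun _ => 0) t ω) (m t ω) i
      simp only [queue, step]
      simp only [control, if_pos h] at hi ⊢
      omega
    -- Nothing is served in the slot where queue `i` is empty, which is why services are counted
    -- from `s + 1`.
    · obtain ⟨i, hi⟩ := not_forall.1 h
      refine ⟨i, t, by omega, ?_⟩
      simp only [queue, step, control, if_neg h]
      simp only [services, arrivals, Ico_self, sum_empty, Nat.Ico_succ_singleton, sum_singleton]
      omega

theorem exists_services_add_le_arrivals (hd : 0 < d) {t K : ℕ} {ω : Ω}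
    (h : ∀ i, K < queue a m (fun _ => 0) t ω i) :
    ∃ i, ∃ s ≤ t, services m s t ω + K ≤ arrivals a i s t ω := by
  obtain ⟨i, s, hst, hs⟩ := exists_queue_zero_add_services (a := a) (m := m) hd t ω
  refine ⟨i, s, hst, ?_⟩
  have hi := h i
  -- Counting the unused slot `s` as well costs at most one, which the strict inequality `K <`
  -- absorbs.
  have h1 : services m s t ω ≤ services m (s + 1) t ω + 1 := by
    rcases hst.eq_or_lt with rfl | hlt
    · simp [services]
    · unfold services
      rw [sum_eq_sum_Ico_succ_bot hlt, add_comm]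
      exact Nat.add_le_add_left (Bool.toNat_le _) _
  omega

/-- A potential which decreases strictly when the server is available and exactly the queues
shorter than the longest one have an arrival. -/
def potential (x : Fin d → ℕ) : ℕ := ∑ i, (2 * univ.sup x - x i)

/-- If all queues are nonempty, the maximum falls by at least one and each queue by at most one; the
factor 2 then makes every summand drop. Otherwise the maximum does not rise, no queue shrinks, and
an empty queue, being below the maximum, grows. -/
theorem potential_step_lt {x : Fin d → ℕ} (hx : x ≠ fun _ => 0) :
    potential (step x (fun i => decide (x i < univ.sup x)) true) < potential x := by
  set M := univ.sup x with hM
  set y := step x (fun i => decide (x i < M)) true with hy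
  have hxM : ∀ i, x i ≤ M := fun i => le_sup (f := x) (mem_univ i)
  obtain ⟨i₀, hi₀⟩ : ∃ i, x i ≠ 0 := by
    by_contra! h
    exact hx (funext h)
  have hM1 : 1 ≤ M := (Nat.one_le_iff_ne_zero.2 hi₀).trans (hxM i₀)
  unfold potential
  rw [← hM]
  by_cases h : ∀ i, 1 ≤ x i
  · have hyi : ∀ i, y i ≤ M - 1 ∧ x i ≤ y i + 1 := by
      intro i
      have h1 := hxM i
      have h2 := h i
      simp only [hy, step, control, if_pos h]
      by_cases h3 : x i < M
      · simp [h3]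
        omega
      · simp [h3]
        omega
    have hs : univ.sup y ≤ M - 1 := Finset.sup_le fun i _ => (hyi i).1
    refine sum_lt_sum_of_nonempty ⟨i₀, mem_univ _⟩ fun i _ => ?_
    have h1 := hxM i
    have h2 := hyi i
    omega
  · have hyi : ∀ i, y i = x i + (decide (x i < M)).toNat := by
      intro i
      simp only [hy, step, control, if_neg h]
      simp
    have hyM : ∀ i, y i ≤ M := by
      intro i
      rw [hyi]
      have h1 := hxM i
      by_cases h3 : x i < M
      · simp [h3]
      · simpa [h3] using h1
    have hs : univ.sup y ≤ M := Finset.sup_le fun i _ => hyM i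
    obtain ⟨j, hj⟩ := not_forall.1 h
    refine sum_lt_sum (fun i _ => ?_) ⟨j, mem_univ j, ?_⟩
    · have := hyi i
      omega
    · have h1 := hyi j
      have h2 : x j < M := by omega
      simp only [h2, decide_true, Bool.toNat_true] at h1
      omega

end Paths

/-! ### Reachability of states -/

section Reach

variable {d : ℕ} {Ω : Type*} {a : ℕ → Fin d → Ω → Bool} {m : ℕ → Ω → Bool}

namespace IsBatchInput

variable [MeasurableSpace Ω] {μ : Measure Ω} [IsProbabilityMeasure μ] {p mbar : ℝ}
  (hinput : IsBatchInput μ p mbar a m)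
include hinput

theorem measureReal_bits (hp : 0 ≤ p) (hm : 0 ≤ mbar) (n : (ℕ × Fin d) ⊕ ℕ) (b : Bool) :
    μ.real {ω | bits a m n ω = b} =
      if b then Sum.elim (fun _ => p) (fun _ => mbar) n
      else 1 - Sum.elim (fun _ => p) (fun _ => mbar) n := by
  have h3 : MeasurableSet {ω | bits a m n ω = true} :=
    hinput.measurable_bits n (measurableSet_singleton true)
  have h1 := hinput.measureReal_bits_true hp hm n
  cases b
  · have h2 : {ω | bits a m n ω = false} = {ω | bits a m n ω = true}ᶜ := by
      ext ω
      simp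
    rw [h2, probReal_compl_eq_one_sub h3, h1]
    simp
  · simpa using h1

theorem measureReal_step_pos (hp : 0 < p) (hp1 : p < 1) (hm : 0 < mbar) (x : Fin d → ℕ)
    (arr : Fin d → Bool) (srv : Bool) (hsrv : srv = false → mbar < 1) :
    0 < μ.real {ω | queue a m x 1 ω = step x arr srv} := by
  set val : (ℕ × Fin d) ⊕ ℕ → Bool := Sum.elim (fun k => arr k.2) (fun _ => srv) with hval
  set T : Finset ((ℕ × Fin d) ⊕ ℕ) := ({0} ×ˢ univ).disjSum {0} with hT
  have hpos : ∀ n, 0 < μ.real {ω | bits a m n ω = val n} := by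
    intro n
    rw [hinput.measureReal_bits hp.le hm.le]
    rcases n with ⟨t, i⟩ | t
    · simp only [Sum.elim_inl]
      split_ifs <;> linarith
    · simp only [Sum.elim_inr]
      split_ifs with h
      · exact hm
      · exact sub_pos.2 (hsrv (by simpa [hval] using h))
  have h1 : μ (⋂ n ∈ T, bits a m n ⁻¹' {val n}) = ∏ n ∈ T, μ (bits a m n ⁻¹' {val n}) :=
    iIndepFun.measure_inter_preimage_eq_mul hinput.indep T fun _ _ => measurableSet_singleton _
  have h2 : 0 < μ.real (⋂ n ∈ T, bits a m n ⁻¹' {val n}) := by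
    rw [measureReal_def, h1, ENNReal.toReal_prod]
    exact prod_pos fun n _ => hpos n
  refine h2.trans_le (measureReal_mono fun ω hω => ?_)
  have h3 := Set.mem_iInter₂.1 hω
  have h4 : (fun i => a 0 i ω) = arr := funext fun i => h3 (Sum.inl (0, i)) (by simp [hT])
  have h5 : m 0 ω = srv := h3 (Sum.inr 0) (by simp [hT])
  simp only [Set.mem_ofPred_eq, queue, h4, h5]

/-- Descent along `potential`. The steps used keep the server available, so the case mbar = 1 is
covered. -/
theorem exists_measureReal_queue_eq_zero_pos (hp : 0 < p) (hp1 : p < 1) (hm : 0 < mbar)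
    (x : Fin d → ℕ) : ∃ t, 0 < μ.real {ω | queue a m x t ω = fun _ => 0} := by
  induction hn : potential x using Nat.strong_induction_on generalizing x with
  | _ n ih =>
    by_cases hx : x = fun _ => 0
    · exact ⟨0, by simp [queue, hx]⟩
    · obtain ⟨t, ht⟩ := ih _ (hn ▸ potential_step_lt hx) _ rfl
      have h1 := hinput.measureReal_step_pos hp hp1 hm x
        (fun i => decide (x i < univ.sup x)) true (by simp)
      exact ⟨1 + t, (mul_pos h1 ht).trans_le (hinput.measureReal_queue_add _ _ _ _ _)⟩

/-- While the server is unavailable, each queue can be filled to its target one customer at a time.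
-/
theorem accessible_of_lt_one (hp : 0 < p) (hp1 : p < 1) (hm : 0 < mbar) (hm1 : mbar < 1)
    (x : Fin d → ℕ) : Accessible μ a m (fun _ => 0) x := by
  have h : ∀ n, 0 < μ.real {ω | queue a m (fun _ => 0) n ω = fun i => min (x i) n} := by
    intro n
    induction n with
    | zero => simp [queue]
    | succ n ih =>
      have h1 := hinput.measureReal_step_pos hp hp1 hm (fun i => min (x i) n)
        (fun i => decide (n < x i)) false fun _ => hm1
      have h2 : step (fun i => min (x i) n) (fun i => decide (n < x i)) false =
          fun i => min (x i) (n + 1) := by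
        funext i
        by_cases h3 : n < x i
        · simp [step, h3]
          omega
        · simp [step, h3]
          omega
      rw [h2] at h1
      exact (mul_pos ih h1).trans_le (hinput.measureReal_queue_add _ _ _ _ _)
  refine ⟨∑ i, x i, ?_⟩
  have h1 := h (∑ i, x i)
  have h2 : (fun i => min (x i) (∑ i, x i)) = x :=
    funext fun i => min_eq_left (single_le_sum (f := x) (fun _ _ => Nat.zero_le _) (mem_univ i))
  rw [h2] at h1
  exact (ENNReal.toReal_pos_iff.1 h1).1

end IsBatchInput

end Reach

/-! ### Order of the return probabilities -/

section Asymptotics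

variable {d : ℕ} {Ω : Type*} {a : ℕ → Fin d → Ω → Bool} {m : ℕ → Ω → Bool}

namespace IsBatchInput

variable [MeasurableSpace Ω] {μ : Measure Ω} [IsProbabilityMeasure μ] {p mbar : ℝ}
  (hinput : IsBatchInput μ p mbar a m)
include hinput

theorem exists_measureReal_queue_eq_self_le (hp : 0 < p) (hp1 : p < 1) (hd : 0 < d)
    (x : Fin d → ℕ) :
    ∃ C : ℝ, 0 ≤ C ∧ ∀ t : ℕ, 0 < t → μ.real {ω | queue a m x t ω = x} ≤ (C / √t) ^ (d - 1) := by
  obtain ⟨C, hC0, hC⟩ := exists_binomialWeight_le hp hp1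
  refine ⟨C, hC0, fun t ht => ?_⟩
  refine (measureReal_mono fun ω hω => mem_balanced_of_queue_eq hω).trans ?_
  exact hinput.measureReal_balanced_le hp.le hp1.le hd (hC t ht)

theorem tendsto_measureReal_queue_eq_self (hp : 0 < p) (hp1 : p < 1) (hd : 2 ≤ d)
    (x : Fin d → ℕ) : Tendsto (fun t => μ.real {ω | queue a m x t ω = x}) atTop (𝓝 0) := by
  obtain ⟨C, _, hC⟩ := hinput.exists_measureReal_queue_eq_self_le hp hp1 (by omega) x
  have h1 : Tendsto (fun t : ℕ => (C / √(t : ℝ)) ^ (d - 1)) atTop (𝓝 (0 ^ (d - 1))) :=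
    ((Real.tendsto_sqrt_atTop.comp tendsto_natCast_atTop_atTop).const_div_atTop C).pow _
  rw [zero_pow (by omega)] at h1
  refine squeeze_zero' (Eventually.of_forall fun _ => measureReal_nonneg) ?_ h1
  filter_upwards [eventually_gt_atTop 0] with t ht using hC t ht

theorem summable_measureReal_queue_eq_self (hp : 0 < p) (hp1 : p < 1) (hd : 4 ≤ d)
    (x : Fin d → ℕ) : Summable fun t => μ.real {ω | queue a m x t ω = x} := by
  obtain ⟨C, hC0, hC⟩ := hinput.exists_measureReal_queue_eq_self_le hp hp1 (by omega) x
  have h1 : Summable fun t : ℕ => C ^ (d - 1) * (1 / (t : ℝ) ^ (3 / 2 : ℝ)) :=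
    (Real.summable_one_div_nat_rpow.2 (by norm_num)).mul_left _
  refine Summable.of_norm_bounded_eventually_nat h1 ?_
  filter_upwards [eventually_gt_atTop 0] with t ht
  rw [Real.norm_of_nonneg measureReal_nonneg]
  refine (hC t ht).trans ?_
  have ht1 : (1 : ℝ) ≤ t := by exact_mod_cast ht
  have h2 : (t : ℝ) ^ (3 / 2 : ℝ) = √(t : ℝ) ^ 3 := by
    rw [Real.sqrt_eq_rpow, ← Real.rpow_natCast, ← Real.rpow_mul (by positivity)]
    norm_num
  have h3 : √(t : ℝ) ^ 3 ≤ √(t : ℝ) ^ (d - 1) :=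
    pow_le_pow_right₀ (Real.one_le_sqrt.2 ht1) (by omega)
  have h4 : 0 < √(t : ℝ) := Real.sqrt_pos.2 (by linarith)
  rw [h2, div_pow, div_eq_mul_one_div]
  gcongr

/-- Started empty, the chain has equal and bounded queues with a probability of the same order as
the probability of equal numbers of arrivals. -/
theorem exists_le_measureReal_queue_const (hp : 0 < p) (hp1 : p < 1) (hpm : p < mbar)
    (hd : 0 < d) : ∃ K : ℕ, ∃ c : ℝ, 0 < c ∧ ∀ t : ℕ, 0 < t →
      c / √t ^ (d - 1) ≤ μ.real {ω | ∃ k ≤ K, queue a m (fun _ => 0) t ω = fun _ => k} := by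
  obtain ⟨C, hC0, hC⟩ := exists_binomialWeight_le hp hp1
  have hδ : 0 < mbar - p := sub_pos.2 hpm
  set ρ : ℝ := Real.exp (-(mbar - p) ^ 2) with hρ
  have hρ0 : 0 ≤ ρ := (Real.exp_pos _).le
  have hρ1 : ρ < 1 := (Real.exp_lt_exp.2 (by nlinarith)).trans_eq Real.exp_zero
  set c : ℝ := (3 / 4) ^ (d - 1 + 1) / 3 ^ (d - 1) with hc
  have hc0 : 0 < c := by positivity
  -- The left side is the total weight of the bad events: d choices of queue, a geometric series
  -- over s and the Hoeffding factor.
  obtain ⟨K, hK0, hK⟩ : ∃ K : ℕ, 0 < K ∧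
      C ^ (d - 1) * (d * (Real.exp (-(K * (mbar - p))) * (1 - ρ)⁻¹)) ≤ c / 2 := by
    have h1 : Tendsto (fun K : ℕ => Real.exp (-(K * (mbar - p)))) atTop (𝓝 0) :=
      Real.tendsto_exp_neg_atTop_nhds_zero.comp
        (tendsto_natCast_atTop_atTop.atTop_mul_const hδ)
    have h2 := ((h1.mul_const (1 - ρ)⁻¹).const_mul (d : ℝ)).const_mul (C ^ (d - 1))
    simp only [zero_mul, mul_zero] at h2
    obtain ⟨K, h3, h4⟩ := ((eventually_gt_atTop 0).and
      (h2.eventually (gt_mem_nhds (half_pos hc0)))).exists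
    exact ⟨K, h3, h4.le⟩
  refine ⟨K, c / 2, half_pos hc0, fun t ht => ?_⟩
  have hst : 0 < √(t : ℝ) := Real.sqrt_pos.2 (by exact_mod_cast ht)
  set E : Fin d → ℕ → Set Ω := fun i s => {ω | services m s t ω + K ≤ arrivals a i s t ω} with hE
  have hbal : c / √(t : ℝ) ^ (d - 1) ≤ μ.real (balanced a t) := by
    refine le_trans (le_of_eq ?_) ((le_sum_binomialWeight_pow hp.le hp1.le ht (d - 1)).trans ?_)
    · rw [hc, mul_pow, div_div]
    · rw [Nat.sub_add_cancel hd]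
      exact hinput.sum_binomialWeight_pow_le hp.le hd t
  have hEi : ∀ i, ∀ s ∈ range (t + 1), μ.real (balanced a t ∩ E i s) ≤
      (C / √t) ^ (d - 1) * (Real.exp (-(K * (mbar - p))) * ρ ^ (t - s)) := by
    intro i s hs
    have hst : s ≤ t := by simpa [Nat.lt_succ_iff] using hs
    have hG : MeasurableSet[bitsAlgebra a m {n | Sum.elim (fun k => k.2) (fun _ => i) n = i}]
        (E i s) := by
      have h1 : Measurable[bitsAlgebra a m {n | Sum.elim (fun k => k.2) (fun _ => i) n = i}]
          (arrivals a i s t) :=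
        SyncQueues.measurable_arrivals (fun u _ => measurable_bits_bitsAlgebra (n := Sum.inl (u, i))
          (S := {n | Sum.elim (fun k => k.2) (fun _ => i) n = i}) rfl) s
      have h2 : Measurable[bitsAlgebra a m {n | Sum.elim (fun k => k.2) (fun _ => i) n = i}]
          (services m s t) :=
        SyncQueues.measurable_services (fun u _ => measurable_bits_bitsAlgebra (n := Sum.inr u)
          (S := {n | Sum.elim (fun k => k.2) (fun _ => i) n = i}) rfl) s
      exact measurableSet_le (h2.add_const K) h1
    refine (hinput.measureReal_balanced_inter_le hp.le hp1.le (hC t ht) i hG).trans ?_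
    exact mul_le_mul_of_nonneg_left
      (hinput.measureReal_services_add_le_arrivals hp.le hpm.le i hst hK0) (by positivity)
  have hsub : balanced a t ⊆ {ω | ∃ k ≤ K, queue a m (fun _ => 0) t ω = fun _ => k} ∪
      ⋃ i ∈ univ, ⋃ s ∈ range (t + 1), balanced a t ∩ E i s := by
    intro ω hω
    -- Starting from equal lengths, equal arrival counts mean equal lengths at time `t`.
    have heq : ∀ i, queue a m (fun _ => 0) t ω i = queue a m (fun _ => 0) t ω ⟨0, hd⟩ := by
      intro i
      have h1 := queue_add_arrivals_add (a := a) (m := m) (fun _ => 0) t ω i ⟨0, hd⟩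
      have h2 := hω i ⟨0, hd⟩
      omega
    by_cases h : queue a m (fun _ => 0) t ω ⟨0, hd⟩ ≤ K
    · exact Or.inl ⟨_, h, funext heq⟩
    · right
      obtain ⟨i, s, hs, h1⟩ := exists_services_add_le_arrivals (a := a) (m := m) (t := t) (K := K)
        (ω := ω) hd fun i => by rw [heq i]; omega
      exact Set.mem_biUnion (mem_univ i) (Set.mem_biUnion (x := s)
        (by simpa [Nat.lt_succ_iff] using hs) ⟨hω, h1⟩)
  have hgeom : ∑ s ∈ range (t + 1), ρ ^ (t - s) ≤ (1 - ρ)⁻¹ := by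
    have h1 : ∑ s ∈ range (t + 1), ρ ^ (t - s) = ∑ s ∈ range (t + 1), ρ ^ s := by
      rw [← sum_range_reflect]
      exact sum_congr rfl fun s hs => by
        have : s ≤ t := by simpa [Nat.lt_succ_iff] using hs
        congr 1
        omega
    rw [h1, ← tsum_geometric_of_lt_one hρ0 hρ1]
    exact (summable_geometric_of_lt_one hρ0 hρ1).sum_le_tsum _ fun _ _ => by positivity
  have hbad : μ.real (⋃ i ∈ univ, ⋃ s ∈ range (t + 1), balanced a t ∩ E i s) ≤
      c / 2 / √(t : ℝ) ^ (d - 1) := by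
    calc _ ≤ ∑ i : Fin d, μ.real (⋃ s ∈ range (t + 1), balanced a t ∩ E i s) :=
          measureReal_biUnion_finset_le _ _
      _ ≤ ∑ _i : Fin d, (C / √t) ^ (d - 1) * (Real.exp (-(K * (mbar - p))) * (1 - ρ)⁻¹) := by
          refine sum_le_sum fun i _ => ?_
          refine (measureReal_biUnion_finset_le _ _).trans ((sum_le_sum (hEi i)).trans ?_)
          rw [← mul_sum, ← mul_sum]
          gcongr
      _ = C ^ (d - 1) * (d * (Real.exp (-(K * (mbar - p))) * (1 - ρ)⁻¹)) / √(t : ℝ) ^ (d - 1) := by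
          rw [sum_const, card_univ, Fintype.card_fin, nsmul_eq_mul, div_pow]
          ring
      _ ≤ _ := by gcongr
  have h1 := hbal.trans ((measureReal_mono hsub (measure_ne_top _ _)).trans
    (measureReal_union_le _ _))
  have h2 : c / √(t : ℝ) ^ (d - 1) = c / 2 / √(t : ℝ) ^ (d - 1) + c / 2 / √(t : ℝ) ^ (d - 1) := by
    rw [← add_div, add_halves]
  linarith

/-- For d ≤ 3 the lower bound dominates the harmonic series, and only finitely many diagonal states
share it. -/
theorem exists_not_summable_measureReal_queue_const (hp : 0 < p) (hp1 : p < 1) (hpm : p < mbar)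
    (hd : 0 < d) (hd3 : d ≤ 3) :
    ∃ k : ℕ, ¬ Summable fun t => μ.real {ω | queue a m (fun _ => 0) t ω = fun _ => k} := by
  obtain ⟨K, c, hc, hK⟩ := hinput.exists_le_measureReal_queue_const hp hp1 hpm hd
  by_contra! h
  have h1 : Summable fun t => ∑ k ∈ range (K + 1),
      μ.real {ω | queue a m (fun _ => 0) t ω = fun _ => k} := summable_sum fun k _ => h k
  have h2 : Summable fun t : ℕ => c * (1 / (t : ℝ)) := by
    refine Summable.of_norm_bounded_eventually_nat h1 ?_
    filter_upwards [eventually_gt_atTop 0] with t ht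
    have ht1 : (1 : ℝ) ≤ t := by exact_mod_cast ht
    have h3 : √(t : ℝ) ^ (d - 1) ≤ t := by
      calc √(t : ℝ) ^ (d - 1) ≤ √(t : ℝ) ^ 2 :=
            pow_le_pow_right₀ (Real.one_le_sqrt.2 ht1) (by omega)
        _ = t := Real.sq_sqrt (by positivity)
    have h4 : 0 < √(t : ℝ) := Real.sqrt_pos.2 (by linarith)
    rw [Real.norm_of_nonneg (by positivity), ← div_eq_mul_one_div]
    calc c / t ≤ c / √(t : ℝ) ^ (d - 1) := by gcongr
      _ ≤ μ.real {ω | ∃ k ≤ K, queue a m (fun _ => 0) t ω = fun _ => k} := hK t ht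
      _ ≤ μ.real (⋃ k ∈ range (K + 1), {ω | queue a m (fun _ => 0) t ω = fun _ => k}) := by
          refine measureReal_mono ?_ (measure_ne_top _ _)
          rintro ω ⟨k, hk, hω⟩
          exact Set.mem_biUnion (x := k) (by simpa [Nat.lt_succ_iff] using hk) hω
      _ ≤ _ := measureReal_biUnion_finset_le _ _
  exact Real.not_summable_one_div_natCast ((summable_mul_left_iff hc.ne').1 h2)

/-- Loops x → 0 → (k,…,k) → 0 → x, whose second leg has variable length `t` and the others fixed
lengths, bound the return probabilities of `x` below by a constant multiple of a non-summable
sequence. -/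
theorem not_summable_measureReal_queue_eq_self (hp : 0 < p) (hp1 : p < 1) (hpm : p < mbar)
    (hd : 0 < d) (hd3 : d ≤ 3) {x : Fin d → ℕ} (hx : Accessible μ a m (fun _ => 0) x) :
    ¬ Summable fun t => μ.real {ω | queue a m x t ω = x} := by
  intro hs
  obtain ⟨k, hk⟩ := hinput.exists_not_summable_measureReal_queue_const hp hp1 hpm hd hd3
  obtain ⟨t₁, h1⟩ := hinput.exists_measureReal_queue_eq_zero_pos hp hp1 (hp.trans hpm) x
  obtain ⟨t₂, h2⟩ := hinput.exists_measureReal_queue_eq_zero_pos hp hp1 (hp.trans hpm) fun _ => k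
  obtain ⟨t₃, h3⟩ := hx
  replace h3 : 0 < μ.real {ω | queue a m (fun _ => 0) t₃ ω = x} :=
    ENNReal.toReal_pos h3.ne' (measure_ne_top _ _)
  refine hk ((summable_mul_left_iff (mul_pos h1 (mul_pos h2 h3)).ne').1 ?_)
  refine Summable.of_nonneg_of_le (fun _ => by positivity) (fun t => ?_)
    ((summable_nat_add_iff (t₁ + t₂ + t₃)).2 hs)
  have e1 := hinput.measureReal_queue_add x (fun _ => 0) (fun _ => k) t₁ t
  have e2 := hinput.measureReal_queue_add x (fun _ => k) (fun _ => 0) (t₁ + t) t₂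
  have e3 := hinput.measureReal_queue_add x (fun _ => 0) x (t₁ + t + t₂) t₃
  rw [show t + (t₁ + t₂ + t₃) = t₁ + t + t₂ + t₃ by ring]
  refine le_trans (le_of_eq ?_) ((mul_le_mul_of_nonneg_right
    ((mul_le_mul_of_nonneg_right e1 h2.le).trans e2) h3.le).trans e3)
  ring

theorem nullRecurrent_of_accessible (hp : 0 < p) (hp1 : p < 1) (hpm : p < mbar)
    (hd : d = 2 ∨ d = 3) {x : Fin d → ℕ} (hx : Accessible μ a m (fun _ => 0) x) :
    NullRecurrent μ a m x :=
  ⟨hinput.measure_returnEvent_eq_one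
      (hinput.not_summable_measureReal_queue_eq_self hp hp1 hpm (by omega) (by omega) hx),
    hinput.lintegral_returnTime_eq_top
      (hinput.tendsto_measureReal_queue_eq_self hp hp1 (by omega) x)⟩

end IsBatchInput

end Asymptotics

end SyncQueues

theorem theorem1 {d : ℕ} {Ω : Type*} [MeasurableSpace Ω] (μ : Measure Ω) [IsProbabilityMeasure μ]
    (p mbar : ℝ) (hp : 0 < p) (hpm : p < mbar) (hmbar : mbar ≤ 1)
    (a : ℕ → Fin d → Ω → Bool) (m : ℕ → Ω → Bool)
    (hinput : SyncQueues.IsBatchInput μ p mbar a m) :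
    (d = 2 ∨ d = 3 →
      (mbar < 1 → ∀ x : Fin d → ℕ, SyncQueues.NullRecurrent μ a m x) ∧
      (∀ x : Fin d → ℕ, SyncQueues.Accessible μ a m (fun _ => 0) x →
        SyncQueues.NullRecurrent μ a m x)) ∧
    (4 ≤ d → ∀ x : Fin d → ℕ, SyncQueues.Transient μ a m x) := by
  have hp1 : p < 1 := hpm.trans_le hmbar
  refine ⟨fun hd => ⟨fun hm1 x => ?_, fun x hx => ?_⟩, fun hd x => ?_⟩
  · exact hinput.nullRecurrent_of_accessible hp hp1 hpm hd
      (hinput.accessible_of_lt_one hp hp1 (hp.trans hpm) hm1 x)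
  · exact hinput.nullRecurrent_of_accessible hp hp1 hpm hd hx
  · exact hinput.measure_returnEvent_lt_one
      (hinput.summable_measureReal_queue_eq_self hp hp1 hd x)
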